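/- A multi-player mean-payoff game $\mathcal G$ consists of a finite non-empty set $N$ of players; for each player $i$ a finite non-empty set $\mathrm{Ac}_i$ of actions (write $\vec{\mathrm{Ac}}=\prod_{i\in N}\mathrm{Ac}_i$ for the set of action profiles); a finite set $\mathrm{St}$ of states with an initial state $s_0$; a transition function $\mathrm{tr}:\mathrm{St}\times\vec{\mathrm{Ac}}\to\mathrm{St}$; a labelling of the states by sets of atomic propositions; and weight functions $w_i:\mathrm{St}\to\mathbb Z$, $i\in N$. A path is an infinite sequence $\pi=(s_0,\vec a^0),(s_1,\vec a^1),\dots$ in $\mathrm{St}\times\vec{\mathrm{Ac}}$, starting in the initial state $s_0$, with $\mathrm{tr}(s_k,\vec a^k)=s_{k+1}$ for all $k\in\mathbb N$; it is ultimately periodic if there are $m\ge 0$ and $p\ge 1$ such that its entries with indices $k$ and $k+p$ coincide for all $k\ge m$. The payoff of player $i$ is $\mathrm{pay}_i(\pi)=\liminf_{n\to\infty}\frac1n\sum_{j=0}^{n-1}w_i(s_j)$, and likewise for sequences that start in another state. A strategy of player $i$ is a finite-state transducer $\sigma_i=(Q_i,q_i^0,\delta_i,\tau_i)$ with a finite non-empty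 set $Q_i$ of internal states, $q_i^0\in Q_i$, $\delta_i:Q_i\times\vec{\mathrm{Ac}}\to Q_i$ and $\tau_i:Q_i\to\mathrm{Ac}_i$. A profile $\vec\sigma=(\sigma_i)_{i\in N}$ and a state $s$ determine the outcome $\pi(\vec\sigma,s)$: start in the state $s$ with internal states $q_i^0$; at step $k$ the action profile is $\vec a^k=(\tau_i(q_i^k))_{i\in N}$, the next state is $\mathrm{tr}(s_k,\vec a^k)$, and $q_i^{k+1}=\delta_i(q_i^k,\vec a^k)$. The profile $\vec\sigma$ is a Nash equilibrium, $\vec\sigma\in\mathrm{NE}(\mathcal G)$, if $\mathrm{pay}_i(\pi(\vec\sigma,s_0))\ge \mathrm{pay}_i(\pi((\vec\sigma_{-i},\sigma_i'),s_0))$ for every player $i$ and every strategy $\sigma'_i$ of $i$. The punishment value of player $i$ at the state $s$ is $\mathrm{pun}_i(s)=\inf_{\vec\sigma_{-i}}\sup_{\sigma_i'}\mathrm{pay}_i(\pi((\vec\sigma_{-i},\sigma_i'),s))$. For $z\in\mathbb R$, a pair $(s,\vec a)\in\mathrm{St}\times\vec{\mathrm{Ac}}$ is $z$-secure for $i$ if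 $\mathrm{pun}_i(\mathrm{tr}(s,(\vec a_{-i},a_i')))\le z$ for every $a'_i\in\mathrm{Ac}_i$. **Theorem.** For every multi-player mean-payoff game $\mathcal G$ and every ultimately periodic path $\pi=(s_0,\vec a^0),(s_1,\vec a^1),\dots$ in it, the following are equivalent: 1. there is $\vec\sigma\in\mathrm{NE}(\mathcal G)$ such that $\pi=\pi(\vec\sigma,s_0)$; 2. there is $\vec z\in\mathbb R^N$ with $z_i\in\{\mathrm{pun}_i(s):s\in\mathrm{St}\}$ for every $i\in N$, such that for every $i\in N$ (a) for all $k\in\mathbb N$ the pair $(s_k,\vec a^k)$ is $z_i$-secure for $i$, and (b) $z_i\le\mathrm{pay}_i(\pi)$. -/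

import Mathlib

namespace RatVerif

universe uN uA uS uP

/-- An arena with set of players `N`, actions `Ac i` for each player `i`, states `St` and atomic
propositions `AP`: an initial state, a transition function on states and action profiles, and a
labelling of the states. -/
structure Arena (N : Type uN) (Ac : N → Type uA) (St : Type uS) (AP : Type uP) where
  init : St
  tr : St → (∀ i, Ac i) → St
  label : St → Set AP

/-- A multi-player mean-payoff game: an arena and an integer weight function on the states for
each player. -/
structure MPGame (N : Type uN) (Ac : N → Type uA) (St : Type uS) (AP : Type uP) extends
    Arena N Ac St AP where
  w : N → St → ℤ

/-- A strategy of player `i`: a finite state machine that reads action profiles and outputs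
actions of `i`. -/
structure Strategy {N : Type uN} (Ac : N → Type uA) (i : N) where
  Q : Type
  finite : Finite Q
  q₀ : Q
  δ : Q → (∀ j, Ac j) → Q
  τ : Q → Ac i

/-- A strategy profile: one strategy for each player. -/
abbrev Profile {N : Type uN} (Ac : N → Type uA) := ∀ i, Strategy Ac i

/-- The mean-payoff value of a real sequence: the limit inferior of the averages of its first `n`
terms. -/
noncomputable def meanPayoff (β : ℕ → ℝ) : ℝ :=
  Filter.liminf (fun n : ℕ => (1 / (n : ℝ)) * ∑ j ∈ Finset.range n, β j) Filter.atTop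

/-- A sequence is ultimately periodic. -/
def UltimatelyPeriodic {X : Type*} (u : ℕ → X) : Prop :=
  ∃ m p : ℕ, 0 < p ∧ ∀ k, m ≤ k → u (k + p) = u k

namespace Arena

variable {N : Type uN} {Ac : N → Type uA} {St : Type uS} {AP : Type uP}

/-- Infinite sequences of pairs (state, action profile) that follow the transition function. -/
def IsPath (A : Arena N Ac St AP) (π : ℕ → St × (∀ i, Ac i)) : Prop :=
  ∀ k, A.tr (π k).1 (π k).2 = (π (k + 1)).1

/-- The state of the arena and the internal states of all machines after `k` steps, when the
profile `σ` is played from the state `s`. -/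
def config (A : Arena N Ac St AP) (σ : Profile Ac) (s : St) : ℕ → St × (∀ i, (σ i).Q)
  | 0 => (s, fun i => (σ i).q₀)
  | k + 1 =>
    (A.tr (A.config σ s k).1 (fun j => (σ j).τ ((A.config σ s k).2 j)),
      fun i => (σ i).δ ((A.config σ s k).2 i) (fun j => (σ j).τ ((A.config σ s k).2 j)))

/-- The path generated by the profile `σ` from the state `s`. -/
def outcome (A : Arena N Ac St AP) (σ : Profile Ac) (s : St) : ℕ → St × (∀ i, Ac i) :=
  fun k => ((A.config σ s k).1, fun j => (σ j).τ ((A.config σ s k).2 j))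

theorem isPath_outcome (A : Arena N Ac St AP) (σ : Profile Ac) (s : St) :
    A.IsPath (A.outcome σ s) := fun _ => rfl

end Arena

namespace MPGame

variable {N : Type uN} {Ac : N → Type uA} {St : Type uS} {AP : Type uP}

/-- The payoff of player `i` on a sequence of states and action profiles. -/
noncomputable def pay (G : MPGame N Ac St AP) (i : N) (π : ℕ → St × (∀ i, Ac i)) : ℝ :=
  meanPayoff (fun k => (G.w i (π k).1 : ℝ))

/-- Nash equilibria for play from the initial state: no player gains by changing strategy alone. -/
def IsNash [DecidableEq N] (G : MPGame N Ac St AP) (σ : Profile Ac) : Prop :=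
  ∀ (i : N) (σ' : Strategy Ac i),
    G.pay i (G.outcome (Function.update σ i σ') G.init) ≤ G.pay i (G.outcome σ G.init)

/-- The punishment value of player `i` at the state `s`: the best payoff that `i` can achieve from
`s` against the worst choice of strategies of the other players. The component `σ i` of the profile
is overwritten, so that only the strategies of the others matter. -/
noncomputable def pun [DecidableEq N] (G : MPGame N Ac St AP) (i : N) (s : St) : ℝ :=
  ⨅ σ : Profile Ac, ⨆ σ' : Strategy Ac i, G.pay i (G.outcome (Function.update σ i σ') s)

/-- The pair `(s, a)` is `z`-secure for player `i`: every action of `i` against the actions of the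
others in `a` leads to a state where the punishment value of `i` is at most `z`. -/
def IsSecure [DecidableEq N] (G : MPGame N Ac St AP) (i : N) (z : ℝ)
    (p : St × (∀ i, Ac i)) : Prop :=
  ∀ a' : Ac i, G.pun i (G.tr p.1 (Function.update p.2 i a')) ≤ z

end MPGame

end RatVerif

/-! A deviation of player `i` at any step, continued arbitrarily, is again a strategy of `i`. In an
equilibrium the punishment value after each deviation is therefore at most the payoff
(`IsNash.pun_le_pay`), and the largest of these values serves as `z i`.

Conversely, the players follow `π`, which needs finite memory because `π` is ultimately periodic,
and punish the first deviator (`exists_isNash`). The obstacle is that the infimum in `pun` has to be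
attained. Fix machines for the others and let `v` be the supremum that `i` achieves against them. In
the product of arena and machines no reachable cycle has average weight above `v`, which yields a
potential (`exists_potential`). Replacing the memory at each state by a reachable one of least
potential makes the others memoryless and still keeps `i` down to `v` (`exists_memoryless_le_iSup`).
As there are finitely many memoryless choices, one of them attains the infimum
(`exists_memoryless_le_pun`). -/

namespace RatVerif

open Filter Topology Finset

/-! ### Bounds for mean payoffs and their invariance under shifts -/

section MeanPayoff

theorem abs_average_le {β : ℕ → ℝ} {W : ℝ} (hβ : ∀ k, |β k| ≤ W) (n : ℕ) :
    |(1 / (n : ℝ)) * ∑ j ∈ range n, β j| ≤ W := by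
  have hW : 0 ≤ W := (abs_nonneg _).trans (hβ 0)
  rcases Nat.eq_zero_or_pos n with rfl | hn
  · simpa using hW
  have hn' : (0 : ℝ) < n := by exact_mod_cast hn
  have h : |∑ j ∈ range n, β j| ≤ n * W := by
    refine (abs_sum_le_sum_abs _ _).trans ?_
    simpa using sum_le_sum (s := range n) fun j _ => hβ j
  rw [abs_mul, abs_of_nonneg (by positivity), one_div, inv_mul_le_iff₀ hn']
  exact h

theorem isBoundedUnder_ge_average {β : ℕ → ℝ} {W : ℝ} (hβ : ∀ k, |β k| ≤ W) :
    IsBoundedUnder (· ≥ ·) atTop (fun n : ℕ => (1 / (n : ℝ)) * ∑ j ∈ range n, β j) :=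
  isBoundedUnder_of ⟨-W, fun n => (abs_le.1 (abs_average_le hβ n)).1⟩

theorem isCoboundedUnder_ge_average {β : ℕ → ℝ} {W : ℝ} (hβ : ∀ k, |β k| ≤ W) :
    IsCoboundedUnder (· ≥ ·) atTop (fun n : ℕ => (1 / (n : ℝ)) * ∑ j ∈ range n, β j) :=
  IsBoundedUnder.isCoboundedUnder_ge
    (isBoundedUnder_of ⟨W, fun n => (abs_le.1 (abs_average_le hβ n)).2⟩)

theorem tendsto_add_const_div (v C : ℝ) :
    Tendsto (fun n : ℕ => v + C / (n : ℝ)) atTop (𝓝 v) := by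
  simpa using (tendsto_const_nhds (x := v)).add (tendsto_const_div_atTop_nhds_zero_nat C)

/-- For `n > 0` the averages are at most `v + C / n`, which tends to `v`. -/
theorem meanPayoff_le {β : ℕ → ℝ} {W v C : ℝ} (hβ : ∀ k, |β k| ≤ W)
    (h : ∀ n, ∑ k ∈ range n, (β k - v) ≤ C) : meanPayoff β ≤ v := by
  have ht := tendsto_add_const_div v C
  rw [← ht.liminf_eq]
  refine liminf_le_liminf ?_ (isBoundedUnder_ge_average hβ) ht.isBoundedUnder_le.isCoboundedUnder_ge
  filter_upwards [eventually_gt_atTop 0] with n hn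
  have hn' : (0 : ℝ) < n := by exact_mod_cast hn
  have := h n
  rw [sum_sub_distrib, sum_const, card_range, nsmul_eq_mul] at this
  rw [one_div, inv_mul_le_iff₀ hn', mul_add, mul_div_cancel₀ _ hn'.ne']
  linarith

theorem le_meanPayoff {β : ℕ → ℝ} {W v C : ℝ} (hβ : ∀ k, |β k| ≤ W)
    (h : ∀ n, C ≤ ∑ k ∈ range n, (β k - v)) : v ≤ meanPayoff β := by
  have ht := tendsto_add_const_div v C
  conv_lhs => rw [← ht.liminf_eq]
  refine liminf_le_liminf ?_ ht.isBoundedUnder_ge (isCoboundedUnder_ge_average hβ)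
  filter_upwards [eventually_gt_atTop 0] with n hn
  have hn' : (0 : ℝ) < n := by exact_mod_cast hn
  have := h n
  rw [sum_sub_distrib, sum_const, card_range, nsmul_eq_mul] at this
  rw [one_div, le_inv_mul_iff₀ hn', mul_add, mul_div_cancel₀ _ hn'.ne']
  linarith

theorem abs_meanPayoff_le {β : ℕ → ℝ} {W : ℝ} (hβ : ∀ k, |β k| ≤ W) : |meanPayoff β| ≤ W := by
  refine abs_le.2 ⟨le_meanPayoff (C := 0) hβ fun n => sum_nonneg fun k _ => ?_,
    meanPayoff_le (C := 0) hβ fun n => sum_nonpos fun k _ => ?_⟩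
  · linarith [(abs_le.1 (hβ k)).1]
  · linarith [(abs_le.1 (hβ k)).2]

theorem liminf_le_liminf_of_le_add {f g e : ℕ → ℝ} (he : Tendsto e atTop (𝓝 0))
    (h : ∀ᶠ n in atTop, f n ≤ g n + e n) (hf : IsBoundedUnder (· ≥ ·) atTop f)
    (hg : IsCoboundedUnder (· ≥ ·) atTop g) : liminf f atTop ≤ liminf g atTop := by
  refine le_of_forall_pos_sub_le fun ε hε => ?_
  refine le_liminf_of_le hg ?_
  have h1 : ∀ᶠ n in atTop, liminf f atTop - ε / 2 < f n :=
    eventually_lt_of_lt_liminf (by linarith) hf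
  have h2 : ∀ᶠ n in atTop, e n < ε / 2 := he.eventually_lt_const (by linarith)
  filter_upwards [h, h1, h2] with n h h1 h2
  linarith

theorem abs_average_add_sub_average_le {β : ℕ → ℝ} {W : ℝ} (hβ : ∀ k, |β k| ≤ W) (k : ℕ) {n : ℕ}
    (hn : 0 < n) :
    |(1 / ((n + k : ℕ) : ℝ)) * ∑ j ∈ range (n + k), β j -
      (1 / (n : ℝ)) * ∑ j ∈ range n, β (k + j)| ≤ (2 * k * W) / n := by
  have hn' : (0 : ℝ) < n := by exact_mod_cast hn
  have hk' : (0 : ℝ) ≤ k := by positivity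
  have hW : 0 ≤ W := (abs_nonneg _).trans (hβ 0)
  have hA : |∑ j ∈ range k, β j| ≤ k * W := by
    refine (abs_sum_le_sum_abs _ _).trans ?_
    simpa using sum_le_sum (s := range k) fun j _ => hβ j
  have hB := abs_average_le (β := fun j => β (k + j)) (fun j => hβ _) n
  rw [add_comm n k, sum_range_add]
  set A := ∑ j ∈ range k, β j
  set B := (1 / (n : ℝ)) * ∑ j ∈ range n, β (k + j) with hBdef
  have hB' : ∑ j ∈ range n, β (k + j) = n * B := by rw [hBdef]; field_simp
  rw [hB']
  -- Both `A` and `k * B` are at most `k * W` in absolute value, whence the constant `2 * k * W`.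
  have : 1 / (((k + n : ℕ) : ℝ)) * (A + n * B) - B = (A - k * B) / (k + n) := by
    push_cast
    field_simp
    ring
  rw [this, abs_div, abs_of_pos (by positivity : (0 : ℝ) < k + n)]
  have h1 : |A - k * B| ≤ 2 * k * W := by
    refine (abs_sub _ _).trans ?_
    rw [abs_mul, abs_of_nonneg hk']
    nlinarith [mul_le_mul_of_nonneg_left hB hk']
  exact div_le_div₀ (by positivity) h1 hn' (by linarith)

theorem meanPayoff_shift {β : ℕ → ℝ} {W : ℝ} (hβ : ∀ k, |β k| ≤ W) (k : ℕ) :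
    meanPayoff (fun j => β (k + j)) = meanPayoff β := by
  have hs : meanPayoff β =
      liminf (fun n : ℕ => (1 / ((n + k : ℕ) : ℝ)) * ∑ j ∈ range (n + k), β j) atTop :=
    (liminf_nat_add (fun n : ℕ => (1 / (n : ℝ)) * ∑ j ∈ range n, β j) k).symm
  have he : Tendsto (fun n : ℕ => (2 * k * W) / (n : ℝ)) atTop (𝓝 0) :=
    tendsto_const_div_atTop_nhds_zero_nat _
  have hd := fun n hn => abs_le.1 (abs_average_add_sub_average_le hβ k (n := n) hn)
  rw [hs]
  refine le_antisymm (liminf_le_liminf_of_le_add he ?_ (isBoundedUnder_ge_average fun j => hβ _) ?_)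
    (liminf_le_liminf_of_le_add he ?_ ?_ (isCoboundedUnder_ge_average fun j => hβ _))
  · filter_upwards [eventually_gt_atTop 0] with n hn
    linarith [(hd n hn).1]
  · exact IsBoundedUnder.isCoboundedUnder_ge
      (isBoundedUnder_of ⟨W, fun n => (abs_le.1 (abs_average_le hβ (n + k))).2⟩)
  · filter_upwards [eventually_gt_atTop 0] with n hn
    linarith [(hd n hn).2]
  · exact isBoundedUnder_of ⟨-W, fun n => (abs_le.1 (abs_average_le hβ (n + k))).1⟩

end MeanPayoff

/-! ### Ultimately periodic sequences and their tails -/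

section UltimatelyPeriodic

theorem UltimatelyPeriodic.finite_range {X : Type*} {u : ℕ → X} (h : UltimatelyPeriodic u) :
    (Set.range u).Finite := by
  obtain ⟨m, p, hp, h⟩ := h
  refine (Set.finite_Iio (m + p)).image u |>.subset ?_
  rintro _ ⟨n, rfl⟩
  induction n using Nat.strong_induction_on with
  | _ n ih =>
    rcases lt_or_ge n (m + p) with hn | hn
    · exact ⟨n, hn, rfl⟩
    · have := ih (n - p) (by omega)
      rwa [← h (n - p) (by omega), Nat.sub_add_cancel (by omega)] at this

/-- With `finite_range`, `u` has only finitely many tails, so tails can be the states of a finite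
machine. -/
theorem UltimatelyPeriodic.shifts {X : Type*} {u : ℕ → X} (h : UltimatelyPeriodic u) :
    UltimatelyPeriodic (fun n k => u (n + k)) := by
  obtain ⟨m, p, hp, h⟩ := h
  refine ⟨m, p, hp, fun n hn => funext fun k => ?_⟩
  change u (n + p + k) = u (n + k)
  rw [add_right_comm]
  exact h _ (by omega)

/-- The sequences that arise from `u` by dropping finitely many terms. -/
def Shifts {X : Type*} (u : ℕ → X) : Type _ := Set.range (fun n k : ℕ => u (n + k))

namespace Shifts

variable {X : Type*} {u : ℕ → X}

/-- The sequence `u` without its first `n` terms. -/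
def drop (u : ℕ → X) (n : ℕ) : Shifts u := ⟨fun k => u (n + k), n, rfl⟩

/-- The first term of a sequence. -/
def head (x : Shifts u) : X := x.1 0

/-- The sequence without its first term. -/
def tail (x : Shifts u) : Shifts u :=
  ⟨fun k => x.1 (k + 1), by
    obtain ⟨_, n, rfl⟩ := x
    exact ⟨n + 1, funext fun k => congrArg u (by omega)⟩⟩

@[simp]
theorem head_drop (n : ℕ) : (drop u n).head = u n := rfl

@[simp]
theorem tail_drop (n : ℕ) : (drop u n).tail = drop u (n + 1) :=
  Subtype.ext (funext fun k => congrArg u (by omega))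

theorem finite (h : UltimatelyPeriodic u) : Finite (Shifts u) :=
  h.shifts.finite_range.to_subtype

end Shifts

end UltimatelyPeriodic

/-! ### Potentials on finite weighted graphs -/

section Potential

/-! Graphs with labelled edges, in which the labels determine the successors. -/

variable {V A : Type*}

/-- The walk from `x` along the labels `α`. -/
def orbit (step : V → A → V) (x : V) (α : ℕ → A) : ℕ → V
  | 0 => x
  | n + 1 => step (orbit step x α n) (α n)

theorem orbit_add (step : V → A → V) (x : V) (α : ℕ → A) (m n : ℕ) :
    orbit step x α (m + n) = orbit step (orbit step x α m) (fun k => α (m + k)) n := by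
  induction n with
  | zero => rfl
  | succ n ih => rw [← add_assoc, orbit, ih, orbit]

theorem orbit_succ' (step : V → A → V) (x : V) (α : ℕ → A) (n : ℕ) :
    orbit step x α (n + 1) = orbit step (step x (α 0)) (fun k => α (k + 1)) n := by
  rw [add_comm, orbit_add]
  simp only [add_comm 1]
  rfl

/-- The total weight of the walk from `x` along a word, without its last vertex. -/
def walkWeight (step : V → A → V) (c : V → ℝ) : V → List A → ℝ
  | _, [] => 0
  | x, a :: l => c x + walkWeight step c (step x a) l

theorem walkWeight_append (step : V → A → V) (c : V → ℝ) (x : V) (l l' : List A) :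
    walkWeight step c x (l ++ l') =
      walkWeight step c x l + walkWeight step c (l.foldl step x) l' := by
  induction l generalizing x with
  | nil => simp [walkWeight]
  | cons a l ih => simp [walkWeight, ih, add_assoc]

theorem orbit_length (step : V → A → V) {x : V} {α : ℕ → A} {l : List A}
    (h : ∀ k (hk : k < l.length), α k = l[k]) : orbit step x α l.length = l.foldl step x := by
  induction l generalizing x α with
  | nil => rfl
  | cons a l ih =>
    rw [List.length_cons, orbit_succ', ih fun k hk => h (k + 1) (Nat.succ_lt_succ hk)]
    simp [h 0 (by simp)]

theorem sum_orbit (step : V → A → V) (c : V → ℝ) {x : V} {α : ℕ → A} {l : List A}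
    (h : ∀ k (hk : k < l.length), α k = l[k]) :
    ∑ k ∈ range l.length, c (orbit step x α k) = walkWeight step c x l := by
  induction l generalizing x α with
  | nil => rfl
  | cons a l ih =>
    rw [List.length_cons, sum_range_succ', walkWeight, add_comm]
    simp only [orbit_succ']
    rw [ih fun k hk => h (k + 1) (Nat.succ_lt_succ hk)]
    simp [h 0 (by simp), orbit]

/-- A walk with more steps than there are vertices contains a cycle. Cutting it out does not lower
the weight, so short walks give the bound. -/
theorem walkWeight_le [Finite V] (step : V → A → V) (c : V → ℝ) {x : V}
    (hc : ∀ l l' : List A, l'.foldl step (l.foldl step x) = l.foldl step x →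
      walkWeight step c (l.foldl step x) l' ≤ 0) :
    ∃ C, ∀ l, walkWeight step c x l ≤ C := by
  have := Fintype.ofFinite V
  obtain ⟨W, hW0, hW⟩ : ∃ W, 0 ≤ W ∧ ∀ x, c x ≤ W := by
    obtain ⟨W, hW⟩ := (Set.finite_range c).bddAbove
    exact ⟨max W 0, le_max_right _ _, fun x => (hW ⟨x, rfl⟩).trans (le_max_left _ _)⟩
  have hlen : ∀ (l : List A) (x : V), walkWeight step c x l ≤ l.length * W := by
    intro l
    induction l with
    | nil => simp [walkWeight]
    | cons a l ih =>
      intro x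
      rw [walkWeight, List.length_cons]
      push_cast
      linarith [hW x, ih (step x a)]
  refine ⟨Fintype.card V * W, fun l => ?_⟩
  induction hn : l.length using Nat.strong_induction_on generalizing l with
  | _ n ih =>
    rcases le_or_gt l.length (Fintype.card V) with h | h
    · exact (hlen l x).trans (mul_le_mul_of_nonneg_right (by exact_mod_cast h) hW0)
    · let M : DFA A V := ⟨step, x, ∅⟩
      obtain ⟨q, l₁, l₂, l₃, rfl, -, hne, h₁, h₂, -⟩ :=
        M.evalFrom_split (s := x) h.le rfl
      change l₁.foldl step x = q at h₁
      change l₂.foldl step q = q at h₂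
      have hpos : 0 < l₂.length := List.length_pos_iff.2 hne
      have h3 := ih (l₁ ++ l₃).length (by simp at hn ⊢; omega) (l₁ ++ l₃) rfl
      have h4 := hc l₁ l₂ (by rw [h₁, h₂])
      rw [walkWeight_append] at h3
      rw [walkWeight_append, walkWeight_append, List.foldl_append, h₁, h₂]
      rw [h₁] at h3 h4
      linarith

/-- If every ultimately periodic walk from `x₀` has mean payoff at most `v`, then on the vertices
reachable from `x₀` there is a potential that decreases along every edge by at least the amount by
which the weight exceeds `v`. -/
theorem exists_potential [Finite V] (step : V → A → V) (c : V → ℝ) (x₀ : V) (v : ℝ)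
    (h : ∀ α : ℕ → A, UltimatelyPeriodic α → meanPayoff (fun k => c (orbit step x₀ α k)) ≤ v) :
    ∃ Φ : V → ℝ, ∀ (l : List A) (a : A),
      c (l.foldl step x₀) - v + Φ (step (l.foldl step x₀) a) ≤ Φ (l.foldl step x₀) := by
  obtain ⟨W, hW⟩ : ∃ W, ∀ x, |c x| ≤ W := by
    obtain ⟨W, hW⟩ := (Set.finite_range fun x => |c x|).bddAbove
    exact ⟨W, fun x => hW ⟨x, rfl⟩⟩
  have hcyc : ∀ l l' : List A, l'.foldl step (l.foldl step x₀) = l.foldl step x₀ →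
      walkWeight step (fun x => c x - v) (l.foldl step x₀) l' ≤ 0 := by
    intro l l' hl
    by_contra! hpos
    have hp : 0 < l'.length := by
      rcases l' with _ | ⟨a, l'⟩
      · simp [walkWeight] at hpos
      · simp
    set m := l.length with hm
    set p := l'.length with hpdef
    set S := walkWeight step (fun x => c x - v) (l.foldl step x₀) l' with hS
    -- The word `l` followed by `l'` forever: a cycle of positive weight, repeated, would beat `v`
    -- by `S / p` per step.
    let α : ℕ → A := fun k => if hk : k < m then l[k] else
      l'[(k - m) % p]'(Nat.mod_lt _ hp)
    have hα : ∀ k, m ≤ k → α (k + p) = α k := by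
      intro k hk
      have e : (k + p - m) % p = (k - m) % p := by
        rw [show k + p - m = k - m + p by omega, Nat.add_mod_right]
      simp only [α, dif_neg (show ¬ k + p < m by omega), dif_neg (show ¬ k < m by omega), e]
    have hx : orbit step x₀ α m = l.foldl step x₀ :=
      orbit_length step fun k hk => dif_pos hk
    have hα' : ∀ k (hk : k < l'.length), α (m + k) = l'[k] := by
      intro k hk
      simp only [α, dif_neg (show ¬ m + k < m by omega), Nat.add_sub_cancel_left,
        Nat.mod_eq_of_lt (show k < p from hk)]
    have hxp : orbit step x₀ α (m + p) = orbit step x₀ α m := by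
      rw [orbit_add, orbit_length step hα', hx, hl]
    have hper : ∀ n, orbit step x₀ α (m + n + p) = orbit step x₀ α (m + n) := by
      intro n
      induction n with
      | zero => exact hxp
      | succ n ih =>
        rw [← add_assoc, add_right_comm, orbit, ih, orbit, hα _ (by omega)]
    have hsum : ∑ k ∈ range p, (c (orbit step x₀ α (m + k)) - v) = S := by
      simp only [orbit_add, hx]
      exact sum_orbit step (fun x => c x - v) hα'
    have hp' : (0 : ℝ) < p := by exact_mod_cast hp
    -- Each round of the cycle contributes zero to `D`, so `D` is ultimately periodic and hence
    -- bounded.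
    let D : ℕ → ℝ := fun n => ∑ k ∈ range n, (c (orbit step x₀ α k) - (v + S / p))
    have hD : UltimatelyPeriodic D := by
      refine ⟨m, p, hp, fun k hk => ?_⟩
      obtain ⟨n, rfl⟩ := Nat.exists_eq_add_of_le hk
      induction n with
      | zero =>
        simp only [D, add_zero, sum_range_add, ← sub_sub]
        rw [sum_sub_distrib (f := fun k => c (orbit step x₀ α (m + k)) - v), hsum]
        simp only [sum_const, card_range, nsmul_eq_mul, mul_div_cancel₀ _ hp'.ne']
        ring
      | succ n ih =>
        have := ih (by omega)
        simp only [D] at this ⊢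
        rw [← add_assoc, add_right_comm, sum_range_succ, this, sum_range_succ _ (m + n), hper]
    obtain ⟨C, hC⟩ := hD.finite_range.bddBelow
    have h1 : v + S / p ≤ meanPayoff (fun k => c (orbit step x₀ α k)) :=
      le_meanPayoff (fun k => hW _) fun n => hC ⟨n, rfl⟩
    have h2 := h α ⟨m, p, hp, hα⟩
    have h3 : 0 < S / p := div_pos hpos hp'
    linarith
  have hbdd : ∀ l : List A, BddAbove
      (Set.range (walkWeight step (fun x => c x - v) (l.foldl step x₀))) := by
    intro l
    obtain ⟨C, hC⟩ := walkWeight_le step (fun x => c x - v) (x := l.foldl step x₀)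
      (fun l₁ l₂ => by simpa only [List.foldl_append] using hcyc (l ++ l₁) l₂)
    exact ⟨C, by rintro _ ⟨l', rfl⟩; exact hC l'⟩
  -- The potential is the largest surplus collectable from `x`; it is a genuine supremum at
  -- reachable vertices, by `hbdd`.
  refine ⟨fun x => ⨆ l, walkWeight step (fun x => c x - v) x l, fun l a => ?_⟩
  rw [← le_sub_iff_add_le']
  refine ciSup_le fun l' => ?_
  rw [le_sub_iff_add_le']
  exact le_ciSup (hbdd l) (a :: l')

end Potential

/-! ### Strategies as functions of the past action profiles -/

section Machines

universe u uN uA uS uP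

variable {N : Type uN} {Ac : N → Type uA} {St : Type uS} {AP : Type uP}

namespace Strategy

variable {i : N}

/-- The internal state after `k` steps of a play with action profiles `b`. -/
def run (σ : Strategy Ac i) (b : ℕ → ∀ j, Ac j) : ℕ → σ.Q
  | 0 => σ.q₀
  | k + 1 => σ.δ (σ.run b k) (b k)

/-- The action at step `k` of a play with action profiles `b`. -/
def act (σ : Strategy Ac i) (b : ℕ → ∀ j, Ac j) (k : ℕ) : Ac i := σ.τ (σ.run b k)

theorem run_congr (σ : Strategy Ac i) {b b' : ℕ → ∀ j, Ac j} {k : ℕ} (h : ∀ l < k, b l = b' l) :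
    σ.run b k = σ.run b' k := by
  induction k with
  | zero => rfl
  | succ k ih => rw [run, run, ih fun l hl => h l (by omega), h k (by omega)]

theorem act_congr (σ : Strategy Ac i) {b b' : ℕ → ∀ j, Ac j} {k : ℕ} (h : ∀ l < k, b l = b' l) :
    σ.act b k = σ.act b' k := congrArg σ.τ (σ.run_congr h)

/-- A strategy given by a finite state machine whose states lie in an arbitrary universe. -/
noncomputable def ofFinite (i : N) {X : Type u} [Finite X] (x₀ : X) (δ : X → (∀ j, Ac j) → X)
    (τ : X → Ac i) : Strategy Ac i where
  Q := Fin (Nat.card X)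
  finite := inferInstance
  q₀ := Finite.equivFin X x₀
  δ q b := Finite.equivFin X (δ ((Finite.equivFin X).symm q) b)
  τ q := τ ((Finite.equivFin X).symm q)

theorem act_ofFinite {X : Type u} [Finite X] (x₀ : X) (δ : X → (∀ j, Ac j) → X) (τ : X → Ac i)
    (b : ℕ → ∀ j, Ac j) (k : ℕ) : (ofFinite i x₀ δ τ).act b k = τ (orbit δ x₀ b k) := by
  have : ∀ k, (ofFinite i x₀ δ τ).run b k = Finite.equivFin X (orbit δ x₀ b k) := by
    intro k
    induction k with
    | zero => rfl
    | succ k ih => rw [run, ih]; simp [ofFinite, orbit]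
  rw [act, this]
  simp [ofFinite]

/-- An ultimately periodic sequence of actions is played by some strategy. -/
theorem exists_act_eq {α : ℕ → Ac i} (h : UltimatelyPeriodic α) :
    ∃ σ : Strategy Ac i, ∀ b k, σ.act b k = α k := by
  have := Shifts.finite h
  refine ⟨ofFinite i (Shifts.drop α 0) (fun x _ => x.tail) Shifts.head, fun b k => ?_⟩
  have : orbit (fun (x : Shifts α) (_ : ∀ j, Ac j) => x.tail) (Shifts.drop α 0) b k =
      Shifts.drop α k := by
    induction k with
    | zero => rfl
    | succ k ih => rw [orbit, ih, Shifts.tail_drop]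
  rw [act_ofFinite, this, Shifts.head_drop]

instance [∀ i, Nonempty (Ac i)] : Nonempty (Strategy Ac i) :=
  ⟨⟨Unit, inferInstance, (), fun _ _ => (), fun _ => Classical.arbitrary _⟩⟩

/-- The strategy that plays `a` first and then follows `σ`. -/
def prepend (a : Ac i) (σ : Strategy Ac i) : Strategy Ac i where
  Q := Option σ.Q
  finite := have := σ.finite; inferInstance
  q₀ := none
  δ q b := q.elim (some σ.q₀) fun q => some (σ.δ q b)
  τ q := q.elim a σ.τ

@[simp]
theorem act_prepend_zero (a : Ac i) (σ : Strategy Ac i) (b : ℕ → ∀ j, Ac j) :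
    (σ.prepend a).act b 0 = a := rfl

@[simp]
theorem act_prepend_succ (a : Ac i) (σ : Strategy Ac i) (b : ℕ → ∀ j, Ac j) (k : ℕ) :
    (σ.prepend a).act b (k + 1) = σ.act (fun l => b (l + 1)) k := by
  have : ∀ k, (σ.prepend a).run b (k + 1) = some (σ.run (fun l => b (l + 1)) k) := by
    intro k
    induction k with
    | zero => rfl
    | succ k ih => rw [run, ih]; rfl
  rw [act, this]
  rfl

/-- The strategy that continues `σ` after the action profile `b` has been played. -/
def advance (σ : Strategy Ac i) (b : ∀ j, Ac j) : Strategy Ac i where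
  Q := σ.Q
  finite := σ.finite
  q₀ := σ.δ σ.q₀ b
  δ := σ.δ
  τ := σ.τ

theorem act_advance (σ : Strategy Ac i) (b : ℕ → ∀ j, Ac j) (k : ℕ) :
    (σ.advance (b 0)).act (fun l => b (l + 1)) k = σ.act b (k + 1) := by
  have : ∀ k, (σ.advance (b 0)).run (fun l => b (l + 1)) k = σ.run b (k + 1) := by
    intro k
    induction k with
    | zero => rfl
    | succ k ih => rw [run, ih]; rfl
  rw [act, this]
  rfl

end Strategy

namespace Arena

variable (A : Arena N Ac St AP)

/-- The type of configurations depends on the profile. Expressing outcomes through actions alone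
makes different profiles comparable. -/
theorem outcome_act (σ : Profile Ac) (s : St) (k : ℕ) (i : N) :
    (A.outcome σ s k).2 i = (σ i).act (fun l => (A.outcome σ s l).2) k := by
  have : ∀ k, (A.config σ s k).2 i = (σ i).run (fun l => (A.outcome σ s l).2) k := by
    intro k
    induction k with
    | zero => rfl
    | succ k ih => rw [Strategy.run, ← ih]; rfl
  exact congrArg (σ i).τ (this k)

variable {A}

theorem eq_of_actions_eq {π ρ : ℕ → St × (∀ i, Ac i)} (hπ : A.IsPath π) (hρ : A.IsPath ρ)
    (h0 : (π 0).1 = (ρ 0).1) {n : ℕ} (h : ∀ k < n, (π k).2 = (ρ k).2) : (π n).1 = (ρ n).1 := by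
  induction n with
  | zero => exact h0
  | succ n ih => rw [← hπ, ← hρ, ih fun k hk => h k (by omega), h n (by omega)]

/-- The outcome of a profile is the only path whose actions are those of the strategies. -/
theorem eq_outcome {π : ℕ → St × (∀ i, Ac i)} (hπ : A.IsPath π) {σ : Profile Ac} {s : St}
    (h0 : (π 0).1 = s) (h : ∀ k i, (π k).2 i = (σ i).act (fun l => (π l).2) k) :
    π = A.outcome σ s := by
  have hact : ∀ k, (π k).2 = (A.outcome σ s k).2 := by
    intro k
    induction k using Nat.strong_induction_on with
    | _ k ih =>
      funext i
      rw [h, outcome_act]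
      exact (σ i).act_congr ih
  funext k
  exact Prod.ext (eq_of_actions_eq hπ (A.isPath_outcome σ s) h0 fun l _ => hact l) (hact k)

theorem IsPath.drop {π : ℕ → St × (∀ i, Ac i)} (hπ : A.IsPath π) (n : ℕ) :
    A.IsPath (fun k => π (n + k)) := fun k => hπ (n + k)

theorem outcome_succ (σ : Profile Ac) (s : St) :
    (fun k => A.outcome σ s (k + 1)) =
      A.outcome (fun i => (σ i).advance (A.outcome σ s 0).2)
        (A.tr (A.outcome σ s 0).1 (A.outcome σ s 0).2) := by
  refine eq_outcome (fun k => A.isPath_outcome σ s (k + 1)) rfl fun k i => ?_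
  rw [outcome_act]
  exact ((σ i).act_advance (fun l => (A.outcome σ s l).2) k).symm

theorem outcome_update_prepend [DecidableEq N] (σ : Profile Ac) (s : St) {i : N} (a : Ac i)
    (σ' : Strategy Ac i) {b : ∀ j, Ac j} (hb : b = Function.update (A.outcome σ s 0).2 i a) :
    (fun k => A.outcome (Function.update σ i (σ'.prepend a)) s (k + 1)) =
      A.outcome (Function.update (fun j => (σ j).advance b) i σ') (A.tr s b) := by
  have h0 : (A.outcome (Function.update σ i (σ'.prepend a)) s 0).2 = b := by
    funext j
    rw [hb, outcome_act]
    rcases eq_or_ne j i with rfl | hj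
    · simp
    · simp only [Function.update_of_ne hj]
      rfl
  refine eq_outcome (fun k => A.isPath_outcome _ s (k + 1)) ?_ fun k j => ?_
  · rw [← A.isPath_outcome, h0]
    rfl
  · rw [outcome_act]
    rcases eq_or_ne j i with rfl | hj
    · simp
    · simp only [Function.update_of_ne hj]
      rw [← (σ j).act_advance, h0]

end Arena

namespace MPGame

/-! ### Deviations and memoryless punishment -/

section Pay

variable [Finite St] (G : MPGame N Ac St AP)

theorem exists_abs_w_le (i : N) : ∃ W : ℝ, ∀ s, |(G.w i s : ℝ)| ≤ W := by
  obtain ⟨W, hW⟩ := (Set.finite_range fun s => |(G.w i s : ℝ)|).bddAbove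
  exact ⟨W, fun s => hW ⟨s, rfl⟩⟩

theorem exists_abs_pay_le (i : N) : ∃ W : ℝ, ∀ π, |G.pay i π| ≤ W := by
  obtain ⟨W, hW⟩ := G.exists_abs_w_le i
  exact ⟨W, fun π => abs_meanPayoff_le fun k => hW _⟩

theorem pay_drop (i : N) (π : ℕ → St × (∀ i, Ac i)) (n : ℕ) :
    G.pay i (fun k => π (n + k)) = G.pay i π := by
  obtain ⟨W, hW⟩ := G.exists_abs_w_le i
  exact meanPayoff_shift (β := fun k => (G.w i (π k).1 : ℝ)) (fun k => hW _) n

theorem pay_succ (i : N) (π : ℕ → St × (∀ i, Ac i)) :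
    G.pay i (fun k => π (k + 1)) = G.pay i π := by
  simpa only [add_comm] using G.pay_drop i π 1

variable [DecidableEq N]

theorem bddAbove_pay (i : N) (σ : Profile Ac) (s : St) : BddAbove
    (Set.range fun σ' : Strategy Ac i => G.pay i (G.outcome (Function.update σ i σ') s)) := by
  obtain ⟨W, hW⟩ := G.exists_abs_pay_le i
  exact ⟨W, by rintro _ ⟨σ', rfl⟩; exact (abs_le.1 (hW _)).2⟩

/-- Every deviation of player `i` from an outcome, continued by any strategy, has the payoff of a
strategy of `i`. -/
theorem exists_deviation (i : N) (k : ℕ) (σ : Profile Ac) (s : St) (a : Ac i) :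
    ∃ σ₁ : Profile Ac, ∀ σ' : Strategy Ac i, ∃ σ'' : Strategy Ac i,
      G.pay i (G.outcome (Function.update σ i σ'') s) =
        G.pay i (G.outcome (Function.update σ₁ i σ')
          (G.tr (G.outcome σ s k).1 (Function.update (G.outcome σ s k).2 i a))) := by
  induction k generalizing σ s with
  | zero =>
    refine ⟨fun j => (σ j).advance (Function.update (G.outcome σ s 0).2 i a),
      fun σ' => ⟨σ'.prepend a, ?_⟩⟩
    rw [← pay_succ, Arena.outcome_update_prepend σ s a σ' rfl]
    rfl
  | succ k ih =>
    obtain ⟨σ₁, h⟩ := ih (fun j => (σ j).advance (G.outcome σ s 0).2)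
      (G.tr (G.outcome σ s 0).1 (G.outcome σ s 0).2)
    rw [← Arena.outcome_succ] at h
    refine ⟨σ₁, fun σ' => ?_⟩
    obtain ⟨σ'', h⟩ := h σ'
    -- Player `i` first plays as in the outcome, so the play stays on it for one more step.
    refine ⟨σ''.prepend ((G.outcome σ s 0).2 i), ?_⟩
    rw [← h, ← pay_succ,
      Arena.outcome_update_prepend σ s _ σ'' (Function.update_eq_self i _).symm]
    rfl

/-- Whatever the machines of the others do, a memoryless choice of their actions keeps player `i`
down to the same value. -/
theorem exists_memoryless_le_iSup [Finite N] (i : N) (σ : Profile Ac) (s : St) :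
    ∃ μ : St → ∀ j, Ac j, ∀ ρ : ℕ → St × (∀ j, Ac j), G.IsPath ρ → (ρ 0).1 = s →
      (∀ k, ∀ j ≠ i, (ρ k).2 j = μ (ρ k).1 j) →
      G.pay i ρ ≤ ⨆ σ' : Strategy Ac i, G.pay i (G.outcome (Function.update σ i σ') s) := by
  set v := ⨆ σ' : Strategy Ac i, G.pay i (G.outcome (Function.update σ i σ') s)
  have := fun j => (σ j).finite
  -- In this product graph only `i` moves. An ultimately periodic word of actions is a strategy of
  -- `i`, so its payoff is at most `v`.
  let V := St × ∀ j, (σ j).Q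
  let prof : V → Ac i → ∀ j, Ac j := fun x a => Function.update (fun j => (σ j).τ (x.2 j)) i a
  let step : V → Ac i → V := fun x a =>
    (G.tr x.1 (prof x a), fun j => (σ j).δ (x.2 j) (prof x a))
  let x₀ : V := (s, fun j => (σ j).q₀)
  obtain ⟨Φ, hΦ⟩ := exists_potential step (fun x => (G.w i x.1 : ℝ)) x₀ v fun α hα => by
    obtain ⟨σ', hσ'⟩ := Strategy.exists_act_eq hα
    let b : ℕ → ∀ j, Ac j := fun k => prof (orbit step x₀ α k) (α k)
    have hrun : ∀ k j, (orbit step x₀ α k).2 j = (σ j).run b k := by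
      intro k j
      induction k with
      | zero => rfl
      | succ k ih => rw [Strategy.run, ← ih]; rfl
    have : (fun k => ((orbit step x₀ α k).1, b k)) =
        G.outcome (Function.update σ i σ') s := by
      refine Arena.eq_outcome (fun k => rfl) rfl fun k j => ?_
      rcases eq_or_ne j i with rfl | hj
      · simp [hσ', b, prof]
      · rw [Function.update_of_ne hj, Strategy.act]
        have : b k j = (σ j).τ ((orbit step x₀ α k).2 j) := Function.update_of_ne hj _ _
        exact this.trans (congrArg (σ j).τ (hrun k j))
    refine le_trans (le_of_eq ?_) (le_ciSup (G.bddAbove_pay i σ s) σ')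
    rw [← this]
    rfl
  let R : St → Set (∀ j, (σ j).Q) := fun t => {q | ∃ l : List (Ac i), l.foldl step x₀ = (t, q)}
  have hmin : ∀ t, (R t).Nonempty → ∃ q ∈ R t, ∀ q' ∈ R t, Φ (t, q) ≤ Φ (t, q') := fun t ht =>
    Set.exists_min_image (R t) (fun q => Φ (t, q)) (Set.toFinite _) ht
  have hmin' : ∀ t, ∃ q, (R t).Nonempty → q ∈ R t ∧ ∀ q' ∈ R t, Φ (t, q) ≤ Φ (t, q') := by
    intro t
    by_cases ht : (R t).Nonempty
    · obtain ⟨q, hq⟩ := hmin t ht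
      exact ⟨q, fun _ => hq⟩
    · exact ⟨fun j => (σ j).q₀, fun h => (ht h).elim⟩
  choose q hq using hmin'
  -- At `t` the others act as if their memory were `q t`, the reachable memory of least potential.
  refine ⟨fun t j => (σ j).τ (q t j), fun ρ hρ hρ0 hc => ?_⟩
  have hprof : ∀ k, (ρ k).2 = prof ((ρ k).1, q (ρ k).1) ((ρ k).2 i) := by
    intro k
    funext j
    rcases eq_or_ne j i with rfl | hj
    · simp [prof]
    · simp only [prof, Function.update_of_ne hj]
      exact hc k j hj
  -- The edge lowers the potential as required, and resetting the memory to `q` at the new state can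
  -- only lower it further.
  have hnext : ∀ k, (R (ρ k).1).Nonempty → (R (ρ (k + 1)).1).Nonempty ∧
      (G.w i (ρ k).1 : ℝ) - v + Φ ((ρ (k + 1)).1, q (ρ (k + 1)).1) ≤ Φ ((ρ k).1, q (ρ k).1) := by
    intro k hk
    obtain ⟨l, hl⟩ := (hq _ hk).1
    have h1 := hΦ l ((ρ k).2 i)
    have h2 : (step (l.foldl step x₀) ((ρ k).2 i)).1 = (ρ (k + 1)).1 := by
      rw [hl, ← hρ k]
      exact congrArg (G.tr _) (hprof k).symm
    have h3 : (step (l.foldl step x₀) ((ρ k).2 i)).2 ∈ R (ρ (k + 1)).1 :=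
      ⟨l ++ [(ρ k).2 i], by rw [List.foldl_append, ← h2]; rfl⟩
    refine ⟨⟨_, h3⟩, ?_⟩
    have h4 := (hq _ ⟨_, h3⟩).2 _ h3
    rw [← h2] at h4 ⊢
    simp only [hl] at h1 h4 ⊢
    exact (add_le_add_right h4 _).trans h1
  have hR : ∀ k, (R (ρ k).1).Nonempty := by
    intro k
    induction k with
    | zero => exact ⟨fun j => (σ j).q₀, [], by rw [hρ0]; rfl⟩
    | succ k ih => exact (hnext k ih).1
  obtain ⟨C, hC⟩ := (Set.finite_range Φ).bddBelow
  obtain ⟨W, hW⟩ := G.exists_abs_w_le i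
  refine meanPayoff_le (C := Φ ((ρ 0).1, q (ρ 0).1) - C) (fun k => hW _) fun n => ?_
  have : ∑ k ∈ range n, ((G.w i (ρ k).1 : ℝ) - v) ≤
      Φ ((ρ 0).1, q (ρ 0).1) - Φ ((ρ n).1, q (ρ n).1) := by
    induction n with
    | zero => simp
    | succ n ih =>
      rw [sum_range_succ]
      linarith [(hnext n (hR n)).2]
  linarith [hC ⟨((ρ n).1, q (ρ n).1), rfl⟩]

variable [∀ i, Nonempty (Ac i)]

theorem pun_le (i : N) (σ : Profile Ac) (s : St) :
    G.pun i s ≤ ⨆ σ' : Strategy Ac i, G.pay i (G.outcome (Function.update σ i σ') s) := by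
  obtain ⟨W, hW⟩ := G.exists_abs_pay_le i
  refine ciInf_le (f := fun σ : Profile Ac => ⨆ σ' : Strategy Ac i, G.pay i
    (G.outcome (Function.update σ i σ') s)) ⟨-W, ?_⟩ σ
  rintro _ ⟨σ, rfl⟩
  exact (abs_le.1 (hW _)).1.trans (le_ciSup (G.bddAbove_pay i σ s) (Classical.arbitrary _))

/-- The punishment value is enforced by a memoryless choice of the actions of the others. -/
theorem exists_memoryless_le_pun [Finite N] [∀ i, Finite (Ac i)] (i : N) (s : St) :
    ∃ μ : St → ∀ j, Ac j, ∀ ρ : ℕ → St × (∀ j, Ac j), G.IsPath ρ → (ρ 0).1 = s →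
      (∀ k, ∀ j ≠ i, (ρ k).2 j = μ (ρ k).1 j) → G.pay i ρ ≤ G.pun i s := by
  by_contra! h
  choose ρ hρ hρ0 hc hlt using h
  -- The least payoff among finitely many counterexamples still exceeds the infimum, so some profile
  -- `σ` holds `i` strictly below all of them.
  obtain ⟨μ₀, hμ₀⟩ := Finite.exists_min fun μ => G.pay i (ρ μ)
  obtain ⟨σ, hσ⟩ := exists_lt_of_ciInf_lt (hlt μ₀)
  obtain ⟨μ, hμ⟩ := G.exists_memoryless_le_iSup i σ s
  exact absurd (hμ (ρ μ) (hρ μ) (hρ0 μ) (hc μ)) (not_le.2 (hσ.trans_le (hμ₀ μ)))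

theorem IsNash.pun_le_pay {G : MPGame N Ac St AP} {σ : Profile Ac} (hσ : G.IsNash σ) (i : N) (k : ℕ)
    (a : Ac i) :
    G.pun i (G.tr (G.outcome σ G.init k).1 (Function.update (G.outcome σ G.init k).2 i a)) ≤
      G.pay i (G.outcome σ G.init) := by
  obtain ⟨σ₁, h⟩ := G.exists_deviation i k σ G.init a
  refine (G.pun_le i σ₁ _).trans (ciSup_le fun σ' => ?_)
  obtain ⟨σ'', h⟩ := h σ'
  exact h ▸ hσ i σ''

end Pay

/-! ### Trigger strategies -/

section Trigger

variable (G : MPGame N Ac St AP) (π : ℕ → St × (∀ i, Ac i)) (μ : N → St → St → ∀ j, Ac j)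

/-- The internal states of the trigger strategies: the rest of the path `π` as long as nobody has
deviated from it, afterwards a memoryless punishment and the current state of the game. -/
abbrev TriggerState := Shifts π ⊕ ((St → ∀ j, Ac j) × St)

open Classical in
/-- The transitions of the trigger strategies. If player `i` deviates to the state `s`, then the
others play `μ i s` from then on. -/
noncomputable def triggerStep : TriggerState π → (∀ j, Ac j) → TriggerState π
  | .inl x, b =>
    if b = x.head.2 then .inl x.tail
    else if h : ∃ i, ∀ j ≠ i, b j = x.head.2 j then
      .inr (μ h.choose (G.tr x.head.1 b), G.tr x.head.1 b)
    -- A default value: a deviation by a single player never leads here.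
    else .inl x.tail
  | .inr (m, s), b => .inr (m, G.tr s b)

/-- The actions of the trigger strategies. -/
def triggerAct : TriggerState π → ∀ j, Ac j
  | .inl x => x.head.2
  | .inr (m, s) => m s

variable {π}

theorem orbit_triggerStep_inl {b : ℕ → ∀ j, Ac j} {k : ℕ} (h : ∀ l < k, b l = (π l).2) :
    orbit (G.triggerStep π μ) (.inl (Shifts.drop π 0)) b k = .inl (Shifts.drop π k) := by
  induction k with
  | zero => rfl
  | succ k ih =>
    rw [orbit, ih fun l hl => h l (by omega), triggerStep, Shifts.head_drop,
      if_pos (h k (by omega)), Shifts.tail_drop]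

/-- The deviator is unique: if two players could each be the only deviator, `b` would agree with `π`
in every component. -/
theorem triggerStep_deviation {i : N} {b : ∀ j, Ac j} {k : ℕ} (hb : b ≠ (π k).2)
    (h : ∀ j ≠ i, b j = (π k).2 j) :
    G.triggerStep π μ (.inl (Shifts.drop π k)) b =
      .inr (μ i (G.tr (π k).1 b), G.tr (π k).1 b) := by
  have he : ∃ i, ∀ j ≠ i, b j = (Shifts.drop π k).head.2 j := ⟨i, h⟩
  have hi : he.choose = i := by
    by_contra hne
    refine hb (funext fun j => ?_)
    rcases eq_or_ne j i with rfl | hj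
    · exact he.choose_spec j (Ne.symm hne)
    · exact h j hj
  rw [triggerStep, if_neg (show ¬b = (Shifts.drop π k).head.2 from hb), dif_pos he, hi]
  rfl

theorem orbit_triggerStep_inr (m : St → ∀ j, Ac j) {ρ : ℕ → St × (∀ i, Ac i)} (hρ : G.IsPath ρ)
    (k : ℕ) :
    orbit (G.triggerStep π μ) (.inr (m, (ρ 0).1)) (fun l => (ρ l).2) k = .inr (m, (ρ k).1) := by
  induction k with
  | zero => rfl
  | succ k ih => rw [orbit, ih, triggerStep, hρ]

/-- A path on which every player gets at least a bound for the punishment values after deviations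
is the outcome of a Nash equilibrium. -/
theorem exists_isNash [Finite N] [DecidableEq N] [∀ i, Finite (Ac i)] [∀ i, Nonempty (Ac i)]
    [Finite St] (hpath : G.IsPath π) (hinit : (π 0).1 = G.init) (hper : UltimatelyPeriodic π)
    (z : N → ℝ) (hz : ∀ i k, G.IsSecure i (z i) (π k)) (hpay : ∀ i, z i ≤ G.pay i π) :
    ∃ σ : Profile Ac, G.IsNash σ ∧ π = G.outcome σ G.init := by
  choose μ hμ using G.exists_memoryless_le_pun
  have := Shifts.finite hper
  let x₀ : TriggerState π := .inl (Shifts.drop π 0)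
  let σ : Profile Ac := fun i =>
    Strategy.ofFinite i x₀ (G.triggerStep π μ) fun x => triggerAct π x i
  have hσ : π = G.outcome σ G.init := by
    refine Arena.eq_outcome hpath hinit fun k i => ?_
    rw [Strategy.act_ofFinite, orbit_triggerStep_inl G μ fun l _ => rfl]
    rfl
  refine ⟨σ, fun i σ' => ?_, hσ⟩
  rw [← hσ]
  set ρ := G.outcome (Function.update σ i σ') G.init with hρdef
  have hρ : G.IsPath ρ := G.isPath_outcome _ _
  have hact : ∀ k, ∀ j ≠ i, (ρ k).2 j =
      triggerAct π (orbit (G.triggerStep π μ) x₀ (fun l => (ρ l).2) k) j := by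
    intro k j hj
    rw [hρdef, Arena.outcome_act, Function.update_of_ne hj, Strategy.act_ofFinite]
  by_cases hall : ∀ k, (ρ k).2 = (π k).2
  · have : ρ = π := funext fun k =>
      Prod.ext (Arena.eq_of_actions_eq hρ hpath hinit.symm fun l _ => hall l) (hall k)
    rw [this]
  classical
  push Not at hall
  obtain ⟨k, hk, hlt⟩ : ∃ k, (ρ k).2 ≠ (π k).2 ∧ ∀ l < k, (ρ l).2 = (π l).2 :=
    ⟨Nat.find hall, Nat.find_spec hall, fun l hl => by simpa using Nat.find_min hall hl⟩
  have hstate : (ρ k).1 = (π k).1 := Arena.eq_of_actions_eq hρ hpath hinit.symm hlt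
  have horb := orbit_triggerStep_inl G μ hlt
  -- The actions at step `k` are chosen before the deviation is read, so the others still follow
  -- `π`.
  have hdev : ∀ j ≠ i, (ρ k).2 j = (π k).2 j := by
    intro j hj
    rw [hact k j hj, horb]
    rfl
  have hnext : G.tr (π k).1 (ρ k).2 = (ρ (k + 1)).1 := by rw [← hstate, hρ]
  have hupd : Function.update (π k).2 i ((ρ k).2 i) = (ρ k).2 := by
    funext j
    rcases eq_or_ne j i with rfl | hj
    · simp
    · rw [Function.update_of_ne hj, hdev j hj]
  have hpun : G.pun i (ρ (k + 1)).1 ≤ z i := by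
    have := hz i k ((ρ k).2 i)
    rwa [hupd, hnext] at this
  have horb' : ∀ n, orbit (G.triggerStep π μ) x₀ (fun l => (ρ l).2) (k + 1 + n) =
      .inr (μ i (ρ (k + 1)).1, (ρ (k + 1 + n)).1) := by
    intro n
    rw [orbit_add, orbit, horb, triggerStep_deviation G μ hk hdev, hnext]
    exact orbit_triggerStep_inr G μ _ (hρ.drop (k + 1)) n
  -- Payoffs ignore finite prefixes, so only the punished part from step `k + 1` counts.
  rw [← G.pay_drop i ρ (k + 1)]
  refine (hμ i (ρ (k + 1)).1 _ (hρ.drop (k + 1)) rfl fun n j hj => ?_).trans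
    (hpun.trans (hpay i))
  rw [hact _ j hj, horb']
  rfl

end Trigger

end MPGame

end Machines

end RatVerif

/-! ### The characterisation of equilibrium outcomes -/

theorem mainTheorem5 {N : Type*} {Ac : N → Type*} {St : Type*} {AP : Type*}
    [Finite N] [Nonempty N] [DecidableEq N] [∀ i, Finite (Ac i)] [∀ i, Nonempty (Ac i)]
    [Finite St] (G : RatVerif.MPGame N Ac St AP)
    (π : ℕ → St × (∀ i, Ac i)) (hpath : G.IsPath π) (hinit : (π 0).1 = G.init)
    (hper : RatVerif.UltimatelyPeriodic π) :
    (∃ σ : RatVerif.Profile Ac, G.IsNash σ ∧ π = G.outcome σ G.init) ↔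
      ∃ z : N → ℝ, (∀ i, ∃ s : St, z i = G.pun i s) ∧
        ∀ i, (∀ k, G.IsSecure i (z i) (π k)) ∧ z i ≤ G.pay i π := by
  constructor
  · rintro ⟨σ, hσ, rfl⟩
    set π := G.outcome σ G.init
    -- `D i` is finite and non-empty, so `pun` has a maximum on it. Being attained after an actual
    -- deviation, it is bounded by the payoff.
    let D : N → Set St := fun i =>
      Set.range fun x : ℕ × Ac i => G.tr (π x.1).1 (Function.update (π x.1).2 i x.2)
    have hmax : ∀ i, ∃ s ∈ D i, ∀ t ∈ D i, G.pun i t ≤ G.pun i s := fun i =>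
      Set.exists_max_image (D i) (G.pun i) (Set.toFinite _)
        ⟨_, (0, Classical.arbitrary _), rfl⟩
    choose s hs hmax using hmax
    refine ⟨fun i => G.pun i (s i), fun i => ⟨s i, rfl⟩, fun i => ⟨fun k a =>
      hmax i _ ⟨(k, a), rfl⟩, ?_⟩⟩
    obtain ⟨⟨k, a⟩, hka⟩ := hs i
    simp only [← hka]
    exact hσ.pun_le_pay i k a
  · rintro ⟨z, -, hz⟩
    exact G.exists_isNash hpath hinit hper z (fun i => (hz i).1) fun i => (hz i).2
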